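/- Let $M$ be a matroid with ground set $E(M)$ and rank function $r$. A set $I\subseteq E(M)$ is a partial transversal of a finite set system $(A_1,\dots,A_k)$ of subsets of $E(M)$ (repetitions allowed) if there is an injection $\phi:I\to\{1,\dots,k\}$ with $x\in A_{\phi(x)}$ for all $x\in I$. The matroid $M$ is a \emph{fundamental transversal matroid} if there is such a set system, for some $k\ge 0$, whose partial transversals are exactly the independent sets of $M$ and for which $A_i\not\subseteq\bigcup_{j\neq i}A_j$ for every $i$. A \emph{cyclic flat} of $M$ is a flat that is a (possibly empty) union of circuits; $\mathcal{Z}(M)$ is the set of all cyclic flats of $M$. For a family (set) $\mathcal{F}$ of sets, write $\cup\mathcal{F}$ and $\cap\mathcal{F}$ for the union and the intersection of its members. An \emph{intersection of cyclic flats} is a set $\cap\mathcal{G}$ with $\emptyset\neq\mathcal{G}\subseteq\mathcal{Z}(M)$. (1) If $E(M)$ is finite, then the following three statements are equivalent: (a) $M$ is a fundamental transversal matroid; (b) for all families $\mathcal{F}$ of intersections of cyclic flats of $M$, $$r(\cup\mathcal{F})\ \ge\ \sum_{\emptyset\neq\mathcal{F}'\subseteq\mathcal{F}}(-1)^{|\mathcal{F}'|+1}\,r(\cap\mathcal{F}');$$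 (c) for all families $\mathcal{F}$ of intersections of cyclic flats of $M$, $$r(\cup\mathcal{F})\ =\ \sum_{\emptyset\neq\mathcal{F}'\subseteq\mathcal{F}}(-1)^{|\mathcal{F}'|+1}\,r(\cap\mathcal{F}').$$ (2) If $M$ has finite rank and $E(M)$ is arbitrary, possibly infinite, then the following three statements are equivalent: (a) $M$ is a fundamental transversal matroid; (b$'$) $\mathcal{Z}(M)$ is finite and the inequality in (b) holds for all finite families $\mathcal{F}$ of intersections of cyclic flats of $M$; (c$'$) $\mathcal{Z}(M)$ is finite and the equality in (c) holds for all finite families $\mathcal{F}$ of intersections of cyclic flats of $M$. (When $\mathcal{Z}(M)$ is finite, every family of intersections of cyclic flats is finite.) -/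

import Mathlib

namespace Matroid

/-- A cyclic set of `M`: a (possibly empty) union of circuits. -/
def IsCyclicSet {α : Type*} (M : Matroid α) (X : Set α) : Prop :=
  ∃ 𝒞 : Set (Set α), (∀ C ∈ 𝒞, M.IsCircuit C) ∧ X = ⋃₀ 𝒞

/-- The collection `Z(M)` of cyclic flats of `M`. -/
def cyclicFlats {α : Type*} (M : Matroid α) : Set (Set α) :=
  {F | M.IsFlat F ∧ M.IsCyclicSet F}

/-- The sets that are intersections of (one or more) cyclic flats of `M`. -/
def cyclicFlatInters {α : Type*} (M : Matroid α) : Set (Set α) :=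
  {X | ∃ 𝒢 : Set (Set α), 𝒢.Nonempty ∧ 𝒢 ⊆ M.cyclicFlats ∧ X = ⋂₀ 𝒢}

/-- The rank of a set as a natural number (meaningful in matroids of finite rank). -/
noncomputable def natRk {α : Type*} (M : Matroid α) (X : Set α) : ℕ :=
  (M.eRk X).toNat

/-- `I` is a partial transversal of the set system `A`: there is an injection `φ` from `I` to the
index set with `x ∈ A (φ x)` for all `x ∈ I`. -/
def IsPartialTransversal {α ι : Type*} (A : ι → Set α) (I : Set α) : Prop :=
  ∃ φ : I → ι, Function.Injective φ ∧ ∀ x : I, (x : α) ∈ A (φ x)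

/-- `A` is a presentation of `M`: a set system on the ground set whose partial transversals are
exactly the independent sets of `M`. -/
def IsPresentation {α ι : Type*} (M : Matroid α) (A : ι → Set α) : Prop :=
  (∀ i, A i ⊆ M.E) ∧ ∀ I : Set α, M.Indep I ↔ IsPartialTransversal A I

/-- A fundamental transversal matroid: it has a presentation by finitely many sets, each of which
has an element that lies in none of the other sets. -/
def IsFundamentalTransversal {α : Type*} (M : Matroid α) : Prop :=
  ∃ (r : ℕ) (A : Fin r → Set α), M.IsPresentation A ∧
    ∀ i, (A i \ ⋃ (j : Fin r) (_ : j ≠ i), A j).Nonempty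

/-- The alternating sum of `(-1) ^ (|ℱ'| + 1) * r (⋂ ℱ')` over the nonempty subfamilies `ℱ'`
of `ℱ`. -/
noncomputable def alternatingInterRk {α : Type*} (M : Matroid α) (ℱ : Finset (Set α)) : ℤ :=
  ∑ ℱ' ∈ ℱ.powerset with ℱ'.Nonempty,
    (-1 : ℤ) ^ (ℱ'.card + 1) * (M.natRk (⋂₀ (ℱ' : Set (Set α))) : ℤ)

end Matroid

namespace Matroid

open Set

variable {α : Type*} {M : Matroid α} {B C F N X Y : Set α}

/-! All the conditions amount to the existence of a base `B` that spans each cyclic flat `F` by its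
trace `B ∩ F`. Such traces also span all intersections of cyclic flats and unions of these, so rank
there just counts elements of `B`, and inclusion-exclusion gives the equality. Conversely, the
inequality lets such a `B` be assembled from traces, one member of the family at a time
(`exists_indep_forall_subset_closure_inter`). Private elements of a fundamental presentation form
such a base, by Hall's theorem applied to circuits; in return, the complements of the hyperplanes
`M.closure (B \ {b})` form a fundamental presentation. -/

/-- Inclusion-exclusion for the trace of a finite set on a finite family of sets. -/
theorem ncard_inter_sUnion_eq_alternating_sum (hN : N.Finite) (ℱ : Finset (Set α)) :
    ((N ∩ ⋃₀ (ℱ : Set (Set α))).ncard : ℤ) =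
      ∑ ℱ' ∈ ℱ.powerset with ℱ'.Nonempty,
        (-1 : ℤ) ^ (ℱ'.card + 1) * ((N ∩ ⋂₀ (ℱ' : Set (Set α))).ncard : ℤ) := by
  classical
  have key := Finset.inclusion_exclusion_card_biUnion ℱ (fun X ↦ hN.toFinset.filter (· ∈ X))
  have h1 : (N ∩ ⋃₀ (ℱ : Set (Set α))) =
      ((ℱ.biUnion (fun X ↦ hN.toFinset.filter (· ∈ X)) : Finset α) : Set α) := by
    ext x
    simp only [mem_inter_iff, mem_sUnion, Finset.mem_coe, Finset.mem_biUnion, Finset.mem_filter,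
      Finite.mem_toFinset]
    tauto
  rw [h1, ncard_coe_finset, key, Finset.univ_eq_attach,
    ← Finset.sum_attach (ℱ.powerset.filter (·.Nonempty))]
  refine Finset.sum_congr rfl fun t _ ↦ ?_
  congr 2
  rw [← ncard_coe_finset]
  congr 1
  have hne := (Finset.mem_filter.1 t.2).2
  ext x
  rw [Finset.mem_coe, ← Finset.singleton_subset_iff, Finset.le_inf'_iff]
  simp only [Finset.singleton_subset_iff, Finset.mem_filter,
    Finite.mem_toFinset, mem_inter_iff, mem_sInter, Finset.mem_coe]
  obtain ⟨Y, hY⟩ := hne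
  exact ⟨fun h ↦ ⟨(h Y hY).1, fun Z hZ ↦ (h Z hZ).2⟩, fun h Z hZ ↦ ⟨h.1, h.2 Z hZ⟩⟩

theorem natRk_eq_ncard_inter (hI : M.Indep (N ∩ X)) (hX : X ⊆ M.closure (N ∩ X)) :
    M.natRk X = (N ∩ X).ncard := by
  rw [natRk, ← (hI.isBasis_of_subset_of_subset_closure inter_subset_right hX).encard_eq_eRk, ncard]

theorem alternatingInterRk_eq_ncard (hN : N.Finite) {ℱ : Finset (Set α)}
    (h : ∀ ℱ' ⊆ ℱ, ℱ'.Nonempty →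
      M.natRk (⋂₀ (ℱ' : Set (Set α))) = (N ∩ ⋂₀ (ℱ' : Set (Set α))).ncard) :
    M.alternatingInterRk ℱ = (N ∩ ⋃₀ (ℱ : Set (Set α))).ncard := by
  rw [ncard_inter_sUnion_eq_alternating_sum hN, alternatingInterRk]
  refine Finset.sum_congr rfl fun t ht ↦ ?_
  rw [Finset.mem_filter, Finset.mem_powerset] at ht
  rw [h t ht.1 ht.2]

/-- Every member of a family is spanned by its trace on `N`, hence so is the union. -/
theorem sUnion_subset_closure_inter {𝒟 : Set (Set α)} (h : ∀ X ∈ 𝒟, X ⊆ M.closure (N ∩ X)) :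
    ⋃₀ 𝒟 ⊆ M.closure (N ∩ ⋃₀ 𝒟) :=
  sUnion_subset fun X hX ↦ (h X hX).trans
    (M.closure_subset_closure (inter_subset_inter_right N (subset_sUnion_of_mem hX)))

/-- Closure commutes with nonempty intersections of subsets of an independent set. -/
theorem sInter_subset_closure_inter {𝒟 : Set (Set α)} (hN : M.Indep N) (hne : 𝒟.Nonempty)
    (h : ∀ X ∈ 𝒟, X ⊆ M.closure (N ∩ X)) : ⋂₀ 𝒟 ⊆ M.closure (N ∩ ⋂₀ 𝒟) := by
  have h1 := hN.closure_sInter_eq_biInter_closure_of_forall_subset (hne.image (N ∩ ·))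
    (by rintro _ ⟨X, -, rfl⟩; exact inter_subset_left)
  have h2 : ⋂₀ ((N ∩ ·) '' 𝒟) ⊆ N ∩ ⋂₀ 𝒟 := by
    intro x hx
    have hx' : ∀ X ∈ 𝒟, x ∈ N ∩ X := fun X hX ↦ hx _ ⟨X, hX, rfl⟩
    exact ⟨(hx' _ hne.some_mem).1, fun X hX ↦ (hx' X hX).2⟩
  refine Subset.trans ?_ (M.closure_subset_closure h2)
  rw [h1]
  simp only [subset_iInter_iff, forall_mem_image]
  exact fun X hX ↦ (sInter_subset_of_mem hX).trans (h X hX)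

theorem inter_mem_cyclicFlatInters (hX : X ∈ M.cyclicFlatInters) (hY : Y ∈ M.cyclicFlatInters) :
    X ∩ Y ∈ M.cyclicFlatInters := by
  obtain ⟨𝒢, h𝒢, h𝒢', rfl⟩ := hX
  obtain ⟨ℋ, hℋ, hℋ', rfl⟩ := hY
  exact ⟨𝒢 ∪ ℋ, h𝒢.inl, union_subset h𝒢' hℋ', (sInter_union 𝒢 ℋ).symm⟩

theorem mem_cyclicFlatInters_of_mem_cyclicFlats (hF : F ∈ M.cyclicFlats) :
    F ∈ M.cyclicFlatInters :=
  ⟨{F}, singleton_nonempty F, by simpa using hF, (sInter_singleton F).symm⟩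

theorem cyclicFlatInters_finite (h : M.cyclicFlats.Finite) : M.cyclicFlatInters.Finite := by
  refine (h.finite_subsets.image sInter).subset ?_
  rintro X ⟨𝒢, -, h𝒢, rfl⟩
  exact ⟨𝒢, h𝒢, rfl⟩

theorem subset_ground_of_mem_cyclicFlatInters (hX : X ∈ M.cyclicFlatInters) : X ⊆ M.E := by
  obtain ⟨𝒢, hne, h𝒢, rfl⟩ := hX
  exact (sInter_subset_of_mem hne.some_mem).trans (h𝒢 hne.some_mem).1.subset_ground

theorem IsCircuit.closure_mem_cyclicFlats (hC : M.IsCircuit C) : M.closure C ∈ M.cyclicFlats := by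
  refine ⟨isFlat_closure C, {D | M.IsCircuit D ∧ D ⊆ M.closure C}, fun D hD ↦ hD.1,
    Subset.antisymm (fun e he ↦ ?_) (sUnion_subset fun D hD ↦ hD.2)⟩
  by_cases heC : e ∈ C
  · exact ⟨C, ⟨hC, M.subset_closure C hC.subset_ground⟩, heC⟩
  obtain ⟨D, hDC, hD, heD⟩ := exists_isCircuit_of_mem_closure he heC
  exact ⟨D, ⟨hD, hDC.trans (insert_subset he (M.subset_closure C hC.subset_ground))⟩, heD⟩

theorem IsCyclicSet.exists_isCircuit_mem (hX : M.IsCyclicSet X) {e : α} (he : e ∈ X) :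
    ∃ D, M.IsCircuit D ∧ D ⊆ X ∧ e ∈ D := by
  obtain ⟨𝒞, h𝒞, rfl⟩ := hX
  obtain ⟨D, hD, heD⟩ := he
  exact ⟨D, h𝒞 D hD, subset_sUnion_of_mem hD, heD⟩

/-- A base that meets every cyclic flat in a spanning subset of the flat. -/
def IsCyclicFlatBase (M : Matroid α) (B : Set α) : Prop :=
  M.IsBase B ∧ ∀ F ∈ M.cyclicFlats, F ⊆ M.closure (B ∩ F)

theorem IsCyclicFlatBase.subset_closure_inter (hB : M.IsCyclicFlatBase B)
    (hX : X ∈ M.cyclicFlatInters) : X ⊆ M.closure (B ∩ X) := by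
  obtain ⟨𝒢, hne, h𝒢, rfl⟩ := hX
  exact sInter_subset_closure_inter hB.1.indep hne fun F hF ↦ hB.2 F (h𝒢 hF)

/-- A cyclic flat is the closure of its trace on the finite set `B`, so it is determined by that
trace. -/
theorem IsCyclicFlatBase.finite_cyclicFlats [M.RankFinite] (hB : M.IsCyclicFlatBase B) :
    M.cyclicFlats.Finite := by
  refine (hB.1.finite.finite_subsets.image M.closure).subset fun F hF ↦ ?_
  refine ⟨B ∩ F, inter_subset_left, Subset.antisymm ?_ (hB.2 F hF)⟩
  exact (M.closure_subset_closure inter_subset_right).trans hF.1.closure.subset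

theorem IsCyclicFlatBase.natRk_sUnion_eq [M.RankFinite] (hB : M.IsCyclicFlatBase B)
    {ℱ : Finset (Set α)} (hℱ : (ℱ : Set (Set α)) ⊆ M.cyclicFlatInters) :
    (M.natRk (⋃₀ (ℱ : Set (Set α))) : ℤ) = M.alternatingInterRk ℱ := by
  have hsp : ∀ X ∈ ℱ, X ⊆ M.closure (B ∩ X) := fun X hX ↦ hB.subset_closure_inter (hℱ hX)
  rw [alternatingInterRk_eq_ncard hB.1.finite, natRk_eq_ncard_inter
    (hB.1.indep.subset inter_subset_left) (sUnion_subset_closure_inter hsp)]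
  intro ℱ' hss hne
  exact natRk_eq_ncard_inter (hB.1.indep.subset inter_subset_left)
    (sInter_subset_closure_inter hB.1.indep hne fun X hX ↦ hsp X (hss hX))

/-! ### From the rank inequality to a base -/

/-- If the rank inequality holds for all subfamilies of an intersection-closed finite family, then
some independent set meets every member of the family in a spanning subset of that member. -/
theorem exists_indep_forall_subset_closure_inter [M.RankFinite] (𝒟 : Finset (Set α))
    (hE : ∀ X ∈ 𝒟, X ⊆ M.E) (hinter : ∀ X ∈ 𝒟, ∀ Y ∈ 𝒟, X ∩ Y ∈ 𝒟)
    (hle : ∀ ℱ ⊆ 𝒟, M.alternatingInterRk ℱ ≤ (M.natRk (⋃₀ (ℱ : Set (Set α))) : ℤ)) :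
    ∃ N, N ⊆ ⋃₀ (𝒟 : Set (Set α)) ∧ M.Indep N ∧ ∀ X ∈ 𝒟, X ⊆ M.closure (N ∩ X) := by
  classical
  induction 𝒟 using Finset.strongInduction with
  | H 𝒟 ih =>
  obtain rfl | hne := 𝒟.eq_empty_or_nonempty
  · exact ⟨∅, by simp, M.empty_indep, by simp⟩
  -- Removing a maximal member keeps the family closed under intersection.
  obtain ⟨X, hX⟩ := 𝒟.exists_maximal hne
  have hXmax : ∀ Y ∈ 𝒟, X ⊆ Y → Y = X := fun Y hY hXY ↦ (hX.2 hY hXY).antisymm hXY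
  have hmeet : ∀ Y ∈ 𝒟.erase X, X ∩ Y ∈ 𝒟.erase X := by
    intro Y hY
    rw [Finset.mem_erase] at hY ⊢
    exact ⟨fun h ↦ hY.1 (hXmax Y hY.2 (inter_eq_left.1 h)), hinter X hX.1 Y hY.2⟩
  obtain ⟨N', hN'ss, hN', hsp'⟩ := ih _ (Finset.erase_ssubset hX.1)
    (fun Y hY ↦ hE Y (Finset.mem_of_mem_erase hY))
    (fun Y hY Z hZ ↦ Finset.mem_erase.2 ⟨fun h ↦ (Finset.mem_erase.1 hY).1
      (hXmax Y (Finset.mem_of_mem_erase hY) (h ▸ inter_subset_left)),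
      hinter Y (Finset.mem_of_mem_erase hY) Z (Finset.mem_of_mem_erase hZ)⟩)
    (fun ℱ hℱ ↦ hle ℱ (hℱ.trans (Finset.erase_subset _ _)))
  obtain ⟨J, hJ, hJss⟩ := (hN'.subset (inter_subset_left (t := X))).subset_isBasis_of_subset
    inter_subset_right (hE X hX.1)
  have hspN : ∀ Y ∈ 𝒟, Y ⊆ M.closure ((N' ∪ J) ∩ Y) := by
    intro Y hY
    obtain rfl | hne := eq_or_ne Y X
    · exact hJ.subset_closure.trans (M.closure_subset_closure
        (subset_inter subset_union_right hJ.subset))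
    exact (hsp' Y (Finset.mem_erase.2 ⟨hne, hY⟩)).trans (M.closure_subset_closure
        (inter_subset_inter_left _ subset_union_left))
  -- New elements of `J` avoid every other member `Y`: the trace of `N'` on `X ∩ Y` lies in `J` and
  -- already spans `X ∩ Y`.
  have hJY : ∀ Y ∈ 𝒟.erase X, J ∩ Y ⊆ N' := by
    intro Y hY e he
    by_contra heN
    have h1 : e ∈ M.closure (N' ∩ (X ∩ Y)) := hsp' _ (hmeet Y hY) ⟨hJ.subset he.1, he.2⟩
    refine hJ.indep.notMem_closure_sdiff_of_mem he.1 (M.closure_subset_closure ?_ h1)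
    exact fun x hx ↦ ⟨hJss ⟨hx.1, hx.2.1⟩, fun hxe ↦ heN (mem_singleton_iff.1 hxe ▸ hx.1)⟩
  have hind : ∀ Y ∈ 𝒟, M.Indep ((N' ∪ J) ∩ Y) := by
    intro Y hY
    obtain rfl | hne := eq_or_ne Y X
    · refine hJ.indep.subset ?_
      rw [union_inter_distrib_right]
      exact union_subset hJss inter_subset_left
    refine hN'.subset ?_
    rw [union_inter_distrib_right]
    exact union_subset inter_subset_left (hJY Y (Finset.mem_erase.2 ⟨hne, hY⟩))
  have hNss : N' ∪ J ⊆ ⋃₀ (𝒟 : Set (Set α)) :=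
    union_subset (hN'ss.trans (sUnion_mono (by simp)))
      (hJ.subset.trans (subset_sUnion_of_mem hX.1))
  have hNfin : (N' ∪ J).Finite := hN'.finite.union hJ.indep.finite
  have hmem : ∀ ℱ' : Finset (Set α), ℱ'.Nonempty → ℱ' ⊆ 𝒟 → ⋂₀ (ℱ' : Set (Set α)) ∈ 𝒟 := by
    intro ℱ' hne
    induction hne using Finset.Nonempty.cons_induction with
    | singleton a => simp
    | cons a s h hs ih =>
      intro hss
      rw [Finset.cons_subset] at hss
      simpa using hinter a hss.1 _ (ih hss.2)
  refine ⟨N' ∪ J, hNss, ?_, hspN⟩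
  -- The traces on all intersections are bases of them, so the alternating sum is the size of `N' ∪
  -- J`. The inequality for all of `𝒟` bounds this by the rank of the union, which `N' ∪ J` spans;
  -- hence independence.
  have hcard := alternatingInterRk_eq_ncard (M := M) hNfin (ℱ := 𝒟) fun ℱ' hss hne ↦
    natRk_eq_ncard_inter (hind _ (hmem ℱ' hne hss)) (hspN _ (hmem ℱ' hne hss))
  have hle' := hle 𝒟 Finset.Subset.rfl
  rw [hcard, inter_eq_self_of_subset_left hNss, Nat.cast_le, natRk] at hle'
  have hspU := sUnion_subset_closure_inter hspN
  rw [inter_eq_self_of_subset_left (t := ⋃₀ (𝒟 : Set (Set α))) hNss] at hspU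
  refine IsBasis.indep (X := ⋃₀ (𝒟 : Set (Set α)))
    ((M.isRkFinite_set _).isBasis_of_subset_closure_of_subset_of_encard_le hspU hNss ?_)
  rw [← hNfin.cast_ncard_eq, ← ENat.natCast_toNat (eRk_ne_top_iff.2 (M.isRkFinite_set _))]
  exact_mod_cast hle'

theorem exists_isCyclicFlatBase [M.RankFinite] (hfin : M.cyclicFlats.Finite)
    (hle : ∀ ℱ : Finset (Set α), (ℱ : Set (Set α)) ⊆ M.cyclicFlatInters →
      M.alternatingInterRk ℱ ≤ (M.natRk (⋃₀ (ℱ : Set (Set α))) : ℤ)) :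
    ∃ B, M.IsCyclicFlatBase B := by
  have hfin' := cyclicFlatInters_finite hfin
  obtain ⟨N, -, hN, hsp⟩ := exists_indep_forall_subset_closure_inter (M := M) hfin'.toFinset
    (fun X hX ↦ subset_ground_of_mem_cyclicFlatInters (hfin'.mem_toFinset.1 hX))
    (fun X hX Y hY ↦ hfin'.mem_toFinset.2
      (inter_mem_cyclicFlatInters (hfin'.mem_toFinset.1 hX) (hfin'.mem_toFinset.1 hY)))
    (fun ℱ hℱ ↦ hle ℱ fun X hX ↦ hfin'.mem_toFinset.1 (hℱ hX))
  obtain ⟨B, hB, hNB⟩ := hN.exists_isBase_superset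
  exact ⟨B, hB, fun F hF ↦ (hsp F (hfin'.mem_toFinset.2
    (mem_cyclicFlatInters_of_mem_cyclicFlats hF))).trans
    (M.closure_subset_closure (inter_subset_inter_left F hNB))⟩

/-! ### Transversals and presentations -/

theorem IsPartialTransversal.mono {ι : Type*} {A : ι → Set α} {I J : Set α}
    (hI : IsPartialTransversal A I) (hJI : J ⊆ I) : IsPartialTransversal A J := by
  obtain ⟨φ, hφ, hA⟩ := hI
  exact ⟨fun x ↦ φ ⟨x, hJI x.2⟩, fun x y h ↦ Subtype.ext (by simpa using hφ h), fun x ↦ hA _⟩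

/-- A partial transversal has at most as many elements as there are sets meeting it. -/
theorem IsPartialTransversal.encard_le {ι : Type*} {A : ι → Set α} {I : Set α} {T : Set ι}
    (hI : IsPartialTransversal A I) (hT : ∀ x ∈ I, ∀ i, x ∈ A i → i ∈ T) :
    I.encard ≤ T.encard := by
  obtain ⟨φ, hφ, hA⟩ := hI
  exact (Function.Embedding.encard_le ⟨fun x : I ↦ (⟨φ x, hT x x.2 _ (hA x)⟩ : T),
    fun x y h ↦ hφ (congrArg Subtype.val h)⟩)

/-- Hall's theorem for partial transversals. -/
theorem isPartialTransversal_of_forall_encard_le {ι : Type*} {A : ι → Set α} {I : Set α}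
    [Finite ι] (h : ∀ J ⊆ I, J.Finite → J.encard ≤ {i | (J ∩ A i).Nonempty}.encard) :
    IsPartialTransversal A I := by
  classical
  have := Fintype.ofFinite ι
  obtain ⟨φ, hφ, hA⟩ := (Finset.all_card_le_biUnion_card_iff_exists_injective
    (fun x : I ↦ (Finset.univ.filter fun i ↦ (x : α) ∈ A i))).1 (fun s ↦ by
      have h1 := h ((↑) '' (s : Set I)) (by simp) (s.finite_toSet.image _)
      rw [Subtype.val_injective.encard_image, encard_coe_eq_coe_finsetCard] at h1
      have h2 : {i | (((↑) '' (s : Set I) : Set α) ∩ A i).Nonempty} =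
          ((s.biUnion fun x : I ↦ (Finset.univ.filter fun i ↦ (x : α) ∈ A i) : Finset ι) :
            Set ι) := by
        ext i
        simp [Set.Nonempty]
      rw [h2, encard_coe_eq_coe_finsetCard] at h1
      exact_mod_cast h1)
  exact ⟨φ, hφ, fun x ↦ by simpa using hA x⟩

theorem IsFundamentalTransversal.exists_isCyclicFlatBase (h : M.IsFundamentalTransversal) :
    ∃ B, M.IsCyclicFlatBase B := by
  obtain ⟨r, A, ⟨hAE, hA⟩, hpriv⟩ := h
  choose b hb using hpriv
  have hbA : ∀ i, b i ∈ A i := fun i ↦ (hb i).1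
  have hbA' : ∀ i j, b i ∈ A j → j = i := by
    intro i j hij
    by_contra hne
    exact (hb i).2 (mem_iUnion₂.2 ⟨j, hne, hij⟩)
  have hbinj : Function.Injective b := fun i j hij ↦ hbA' j i (hij ▸ hbA i)
  have hbI : M.Indep (range b) := by
    rw [hA]
    refine ⟨fun x ↦ x.2.choose, fun x y hxy ↦ Subtype.ext ?_, fun x ↦ ?_⟩
    · rw [← x.2.choose_spec, ← y.2.choose_spec]
      exact congrArg b hxy
    · nth_rw 1 [← x.2.choose_spec]
      exact hbA _
  have hcardb : ∀ T : Set (Fin r), (b '' T).encard = T.encard := fun T ↦ hbinj.encard_image T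
  have hbase : M.IsBase (range b) := by
    refine hbI.isBase_of_eRk_ge (finite_range b) ?_
    rw [hbI.eRk_eq_encard, ← image_univ, hcardb, eRank_def, eRk_le_iff]
    exact fun I _ hI ↦ ((hA I).1 hI).encard_le fun _ _ _ _ ↦ mem_univ _
  have : M.RankFinite := hbase.rankFinite_of_finite (finite_range b)
  refine ⟨range b, hbase, fun F hF e heF ↦ ?_⟩
  obtain ⟨C, hC, hCF, heC⟩ := hF.2.exists_isCircuit_mem heF
  set T : Set (Fin r) := {i | (C ∩ A i).Nonempty} with hT
  -- Proper subsets of the circuit are independent and so satisfy Hall's condition; it must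
  -- therefore fail at `C` itself.
  have hTle : T.encard ≤ M.eRk C := by
    by_contra! hlt
    have hlt' : C.encard ≤ T.encard := by
      rw [← hC.eRk_add_one_eq]
      exact Order.add_one_le_of_lt hlt
    refine hC.not_indep ((hA C).2 (isPartialTransversal_of_forall_encard_le fun J hJC hJ ↦ ?_))
    obtain rfl | hss := hJC.eq_or_ssubset
    · exact hlt'
    exact ((hA J).1 (hC.ssubset_indep hss)).encard_le fun x hx i hi ↦ ⟨x, hx, hi⟩
  -- Only sets indexed by `T` meet `C ∪ b '' T`. Its rank is thus at most that of `C` and of `b ''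
  -- T`, so all three have the same closure.
  have hunion : M.eRk (C ∪ b '' T) ≤ T.encard := by
    rw [eRk_le_iff]
    refine fun I hI hIi ↦ ((hA I).1 hIi).encard_le fun x hx i hi ↦ ?_
    obtain hxC | ⟨j, hj, rfl⟩ := hI hx
    · exact ⟨x, hxC, hi⟩
    · rwa [hbA' j i hi]
  have hcl1 := (M.isRkFinite_set C).closure_eq_closure_of_subset_of_eRk_ge_eRk
    (subset_union_left (t := b '' T)) (hunion.trans hTle)
  have hcl2 := (M.isRkFinite_set (b '' T)).closure_eq_closure_of_subset_of_eRk_ge_eRk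
    (subset_union_right (s := C)) (by
      rwa [(hbI.subset (image_subset_range b T)).eRk_eq_encard, hcardb])
  have hE : b '' T ⊆ M.E := (image_subset_range b T).trans hbI.subset_ground
  have hTF : b '' T ⊆ F := by
    refine (M.subset_closure _ hE).trans ?_
    rw [hcl2, ← hcl1]
    exact (M.closure_subset_closure hCF).trans hF.1.closure.subset
  have heC' : e ∈ M.closure (b '' T) := by
    rw [hcl2, ← hcl1]
    exact M.subset_closure C hC.subset_ground heC
  exact M.closure_subset_closure (subset_inter (image_subset_range b T) hTF) heC'

/-- The complements of the hyperplanes spanned by `B` minus a point present the matroid. -/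
theorem IsCyclicFlatBase.isPresentation [M.RankFinite] (hB : M.IsCyclicFlatBase B) :
    M.IsPresentation (fun b : B ↦ M.E \ M.closure (B \ {(b : α)})) := by
  have hBfin : Finite B := hB.1.finite
  have hmem : ∀ S : Set α, ∀ e ∈ M.closure (B ∩ S), ∀ b : B,
      e ∈ M.E \ M.closure (B \ {(b : α)}) → (b : α) ∈ S := by
    intro S e he b heb
    by_contra hbS
    refine heb.2 (M.closure_subset_closure ?_ he)
    exact fun x hx ↦ ⟨hx.1, fun hxb ↦ hbS (mem_singleton_iff.1 hxb ▸ hx.2)⟩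
  refine ⟨fun b ↦ sdiff_subset, fun I ↦ ⟨fun hI ↦ ?_, fun hI ↦ ?_⟩⟩
  · refine isPartialTransversal_of_forall_encard_le fun J hJI _ ↦ ?_
    set T : Set B := {b | (J ∩ (M.E \ M.closure (B \ {(b : α)}))).Nonempty} with hT
    have hJE : J ⊆ M.E := hJI.trans hI.subset_ground
    rw [← Subtype.val_injective.encard_image T,
      ← (hB.1.indep.subset (Subtype.coe_image_subset B T)).eRk_eq_encard, ← M.eRk_closure_eq]
    refine (hI.subset hJI).encard_le_eRk_of_subset ?_
    -- `J` lies in the hyperplane of each `b ∉ T`, hence in the closure of `T`. Inserting `B` keeps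
    -- the family nonempty when `T` is everything.
    have hcl := hB.1.indep.closure_sInter_eq_biInter_closure_of_forall_subset
      (Js := insert B ((fun b : B ↦ B \ {(b : α)}) '' Tᶜ)) (insert_nonempty _ _)
      (by rintro _ (rfl | ⟨b, -, rfl⟩); exacts [Subset.rfl, sdiff_subset])
    have hss : ⋂₀ (insert B ((fun b : B ↦ B \ {(b : α)}) '' Tᶜ)) ⊆ (↑) '' T := by
      intro x hx
      have hxB : x ∈ B := hx _ (mem_insert _ _)
      refine ⟨⟨x, hxB⟩, ?_, rfl⟩
      by_contra hxT
      exact (hx _ (mem_insert_of_mem _ ⟨⟨x, hxB⟩, hxT, rfl⟩)).2 rfl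
    refine Subset.trans ?_ (M.closure_subset_closure hss)
    rw [hcl]
    intro e he
    simp only [mem_iInter]
    rintro K (rfl | ⟨b, hb, rfl⟩)
    · rw [hB.1.closure_eq]
      exact hJE he
    · by_contra hcon
      exact hb ⟨e, he, hJE he, hcon⟩
  · have hIE : I ⊆ M.E := by
      obtain ⟨φ, -, hφ⟩ := hI
      exact fun x hx ↦ (hφ ⟨x, hx⟩).1
    by_contra hnI
    obtain ⟨C, hCI, hC⟩ := ((not_indep_iff hIE).1 hnI).exists_isCircuit_subset
    have hF := hB.2 _ hC.closure_mem_cyclicFlats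
    -- Elements of `C` lie only in sets indexed by `B ∩ M.closure C`. There are at most `r(C)` of
    -- these, one too few for a circuit.
    have hle := (hI.mono hCI).encard_le (T := {b : B | (b : α) ∈ M.closure C})
      fun x hx b hxb ↦ hmem (M.closure C) x (hF (M.subset_closure C hC.subset_ground hx)) b hxb
    rw [← Subtype.val_injective.encard_image, ← hC.eRk_add_one_eq, ← M.eRk_closure_eq C] at hle
    have hle2 : ((↑) '' {b : B | (b : α) ∈ M.closure C} : Set α).encard ≤
        M.eRk (M.closure C) := by
      refine (hB.1.indep.subset (Subtype.coe_image_subset B _)).encard_le_eRk_of_subset ?_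
      rintro _ ⟨b, hb, rfl⟩
      exact hb
    have hfin := eRk_ne_top_iff.2 (M.isRkFinite_set (M.closure C))
    exact absurd (hle.trans hle2) (not_le.2 (ENat.lt_add_one_iff hfin |>.2 le_rfl))

theorem IsPartialTransversal.comp_equiv {ι κ : Type*} {A : ι → Set α} (e : κ ≃ ι) {I : Set α} :
    IsPartialTransversal (A ∘ e) I ↔ IsPartialTransversal A I :=
  ⟨fun ⟨φ, hφ, h⟩ ↦ ⟨e ∘ φ, e.injective.comp hφ, h⟩,
    fun ⟨φ, hφ, h⟩ ↦ ⟨e.symm ∘ φ, e.symm.injective.comp hφ, fun x ↦ by simpa using h x⟩⟩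

theorem IsCyclicFlatBase.isFundamentalTransversal [M.RankFinite] (hB : M.IsCyclicFlatBase B) :
    M.IsFundamentalTransversal := by
  have hBfin : Finite B := hB.1.finite
  obtain ⟨hAE, hA⟩ := hB.isPresentation
  let e := (Finite.equivFin B).symm
  refine ⟨Nat.card B, (fun b : B ↦ M.E \ M.closure (B \ {(b : α)})) ∘ e,
    ⟨fun i ↦ hAE (e i), fun I ↦ (hA I).trans (IsPartialTransversal.comp_equiv e).symm⟩,
    fun i ↦ ⟨e i, ?_, ?_⟩⟩
  · exact ⟨hB.1.subset_ground (e i).2, hB.1.indep.notMem_closure_sdiff_of_mem (e i).2⟩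
  · simp only [mem_iUnion, not_exists]
    intro j hj hmem
    refine hmem.2 (M.subset_closure _ (sdiff_subset.trans hB.1.subset_ground) ⟨(e i).2, ?_⟩)
    exact fun h ↦ hj (e.injective (Subtype.ext h)).symm

theorem tfae_isFundamentalTransversal (M : Matroid α) [M.RankFinite] :
    List.TFAE
      [M.IsFundamentalTransversal,
        M.cyclicFlats.Finite ∧
          ∀ ℱ : Finset (Set α), (ℱ : Set (Set α)) ⊆ M.cyclicFlatInters →
            M.alternatingInterRk ℱ ≤ (M.natRk (⋃₀ (ℱ : Set (Set α))) : ℤ),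
        M.cyclicFlats.Finite ∧
          ∀ ℱ : Finset (Set α), (ℱ : Set (Set α)) ⊆ M.cyclicFlatInters →
            (M.natRk (⋃₀ (ℱ : Set (Set α))) : ℤ) = M.alternatingInterRk ℱ] := by
  tfae_have 1 → 3 := fun h ↦ by
    obtain ⟨B, hB⟩ := h.exists_isCyclicFlatBase
    exact ⟨hB.finite_cyclicFlats, fun ℱ hℱ ↦ hB.natRk_sUnion_eq hℱ⟩
  tfae_have 3 → 2 := fun h ↦ ⟨h.1, fun ℱ hℱ ↦ (h.2 ℱ hℱ).ge⟩
  tfae_have 2 → 1 := fun h ↦ by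
    obtain ⟨B, hB⟩ := Matroid.exists_isCyclicFlatBase h.1 h.2
    exact hB.isFundamentalTransversal
  tfae_finish

end Matroid

theorem mainTheorem7 {α : Type*} (M : Matroid α) :
    (M.Finite →
      List.TFAE
        [M.IsFundamentalTransversal,
          ∀ ℱ : Finset (Set α), (ℱ : Set (Set α)) ⊆ M.cyclicFlatInters →
            M.alternatingInterRk ℱ ≤ (M.natRk (⋃₀ (ℱ : Set (Set α))) : ℤ),
          ∀ ℱ : Finset (Set α), (ℱ : Set (Set α)) ⊆ M.cyclicFlatInters →
            (M.natRk (⋃₀ (ℱ : Set (Set α))) : ℤ) = M.alternatingInterRk ℱ]) ∧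
    (M.RankFinite →
      List.TFAE
        [M.IsFundamentalTransversal,
          M.cyclicFlats.Finite ∧
            ∀ ℱ : Finset (Set α), (ℱ : Set (Set α)) ⊆ M.cyclicFlatInters →
              M.alternatingInterRk ℱ ≤ (M.natRk (⋃₀ (ℱ : Set (Set α))) : ℤ),
          M.cyclicFlats.Finite ∧
            ∀ ℱ : Finset (Set α), (ℱ : Set (Set α)) ⊆ M.cyclicFlatInters →
              (M.natRk (⋃₀ (ℱ : Set (Set α))) : ℤ) = M.alternatingInterRk ℱ]) := by
  refine ⟨fun hM ↦ ?_, fun hM ↦ M.tfae_isFundamentalTransversal⟩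
  have hfin : M.cyclicFlats.Finite :=
    hM.ground_finite.finite_subsets.subset fun F hF ↦ hF.1.subset_ground
  simpa only [hfin, true_and] using M.tfae_isFundamentalTransversal
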